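/- A hypergraph $H=(V,\mathcal E)$ consists of a vertex set $V$ and a set $\mathcal E$ of subsets of $V$ (the hyperedges); it is $k$-uniform if every hyperedge has exactly $k$ elements. Its weak chromatic number $\chi(H)$ is the minimum number of colors in a coloring of $V$ for which every hyperedge contains vertices of at least two colors. For $k\le d+1$, a $k$-uniform hypergraph $H=(V,\mathcal E)$ is geometrically embeddable in $\mathbb R^d$ if there is an injection $\iota:V\to\mathbb R^d$ such that $\operatorname{conv}(\iota(h))$ is a $(k-1)$-simplex for every $h\in\mathcal E$, and $$\operatorname{conv}(\iota(h_1))\cap\operatorname{conv}(\iota(h_2))=\operatorname{conv}(\iota(h_1)\cap\iota(h_2))$$ for any two distinct $h_1,h_2\in\mathcal E$. Corollary. For every integer $d\ge 4$ there is an infinite family of pairwise non-isomorphic finite $(d+1)$-uniform hypergraphs, each geometrically embeddable in $\mathbb R^d$, whose weak chromatic numbers are unbounded: for every positive integer $N$ some member $H$ of the family satisfies $\chi(H)\ge N$. -/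

import Mathlib

open scoped Hypergraph

namespace Hypergraph

/-- `H` is `k`-uniform: every hyperedge has exactly `k` vertices. -/
def IsUniform {α : Type*} (H : Hypergraph α) (k : ℕ) : Prop :=
  ∀ e ∈ E(H), e.encard = k

/-- `H` has a weak `k`-coloring: the vertices can be colored with `k` colors so that every
hyperedge attains at least two colors. -/
def WeaklyColorable {α : Type*} (H : Hypergraph α) (k : ℕ) : Prop :=
  ∃ c : V(H) → Fin k, ∀ e ∈ E(H), ∃ x y : V(H), (x : α) ∈ e ∧ (y : α) ∈ e ∧ c x ≠ c y

/-- The weak chromatic number: the least `k` such that `H` is weakly `k`-colorable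
(`⊤` if there is no such `k`). -/
noncomputable def weakChromaticNumber {α : Type*} (H : Hypergraph α) : ℕ∞ :=
  ⨅ k ∈ {k : ℕ | H.WeaklyColorable k}, (k : ℕ∞)

/-- `S` is a simplex with `k` vertices, that is, a `(k - 1)`-simplex: the convex hull of `k`
affinely independent points. -/
def IsSimplexOn {d : ℕ} (k : ℕ) (S : Set (EuclideanSpace ℝ (Fin d))) : Prop :=
  ∃ p : Fin k → EuclideanSpace ℝ (Fin d),
    AffineIndependent ℝ p ∧ S = convexHull ℝ (Set.range p)

/-- A (`k`-uniform) hypergraph is geometrically embeddable in `ℝ^d`: there is an injection `ι` of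
the vertex set into `ℝ^d` such that each hyperedge spans a `(k - 1)`-simplex, and the simplices of
two distinct hyperedges meet exactly in the convex hull of the common vertices. -/
def GeometricallyEmbeddable {α : Type*} (H : Hypergraph α) (k d : ℕ) : Prop :=
  ∃ ι : α → EuclideanSpace ℝ (Fin d), Set.InjOn ι V(H) ∧
    (∀ e ∈ E(H), IsSimplexOn k (convexHull ℝ (ι '' e))) ∧
    ∀ e₁ ∈ E(H), ∀ e₂ ∈ E(H), e₁ ≠ e₂ →
      convexHull ℝ (ι '' e₁) ∩ convexHull ℝ (ι '' e₂) = convexHull ℝ (ι '' e₁ ∩ ι '' e₂)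

/-- Two hypergraphs are isomorphic: some map, injective on the vertices of `H`, carries the vertex
set and the hyperedges of `H` exactly onto those of `H'`. -/
def Isomorphic {α : Type*} (H H' : Hypergraph α) : Prop :=
  ∃ f : α → α, Set.InjOn f V(H) ∧ H.image f = H'

end Hypergraph

/-! The edges are Scarf facets: `d + 1` points whose coordinatewise maximum dominates no other point
of the configuration `X`. Replace a point of `ℤ^(d+1)` by powers of a large base, coordinate by
coordinate. Each facet then has a linear functional equal to `1` on its vertices and greater than
`1` on the rest of `X` (`IsScarfFacet.exists_support`). In an affine chart the difference of two
such functionals separates the two simplices and vanishes only at their common vertices, so every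
hypergraph of Scarf facets embeds (`geometricallyEmbeddable_of_isScarfFacet`).

It remains to find points for which every coloring has a monochromatic facet. Each integer of an
interval receives a word of `T` letters from `d + 2` letters. The coordinates are the integer and
its word, read in lexicographic orders with both signs, so that a monochromatic window at any level
is a facet (`IsWindow.isScarfFacet`).

The letters are chosen greedily. A block of `L` integers with a common prefix contains `d + 1` of
one color, and the most popular pattern on the block settles a fixed fraction of the remaining
colorings. At each level this is done on `(d + 2) ^ T` disjoint blocks. The interval has length only
`2 * L * (d + 2) ^ T`, so for large `T` the savings over `T` levels exceed the number of colorings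
(`exists_letter_sequence_forall_window`). -/

/-- The points `p j` are the unique maxima of the `j`-th coordinate among themselves, and every
other point of `X` exceeds them in some coordinate. -/
def IsScarfFacet {α ι : Type*} (pos : α → ι → ℤ) (X : Set α) (p : ι → α) : Prop :=
  (∀ j, p j ∈ X) ∧ (∀ i j, i ≠ j → pos (p i) j < pos (p j) j) ∧
    ∀ q ∈ X, q ∉ Set.range p → ∃ j, pos (p j) j < pos q j

/-! ### Separation of convex hulls and diagonally dominant systems. -/

theorem mem_convexHull_inter_of_nonpos {E : Type*} [AddCommGroup E] [Module ℝ E] (A : Set E)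
    (φ : E →ᵃ[ℝ] ℝ) (hA : ∀ x ∈ A, φ x ≤ 0) {x : E} (hx : x ∈ convexHull ℝ A) (h0 : 0 ≤ φ x) :
    x ∈ convexHull ℝ (A ∩ {y | φ y = 0}) := by
  -- An open half-space with a convex piece of its boundary added is convex.
  set S : Set E := {y | φ y < 0 ∨ (φ y = 0 ∧ y ∈ convexHull ℝ (A ∩ {y | φ y = 0}))} with hS
  have hle : ∀ y ∈ S, φ y ≤ 0 := fun y hy => hy.elim le_of_lt fun h => h.1.le
  have hconv : Convex ℝ S := by
    rw [convex_iff_forall_pos]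
    intro y hy z hz u v hu hv huv
    have hφ : φ (u • y + v • z) = u * φ y + v * φ z := by
      have := Convex.combo_affine_apply (f := φ) (x := y) (y := z) huv
      simpa using this
    have hy0 := hle y hy
    have hz0 := hle z hz
    rcases hy with hy | hy
    · left
      rw [hφ]
      nlinarith
    · rcases hz with hz | hz
      · left
        rw [hφ]
        nlinarith
      · exact Or.inr ⟨by rw [hφ, hy.1, hz.1]; ring,
          convex_convexHull ℝ _ hy.2 hz.2 hu.le hv.le huv⟩
  have hAS : A ⊆ S := fun y hy => by
    rcases (hA y hy).lt_or_eq with h | h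
    · exact Or.inl h
    · exact Or.inr ⟨h, subset_convexHull ℝ _ ⟨hy, h⟩⟩
  rcases convexHull_min hAS hconv hx with h | h
  · exact absurd h0 (not_le.2 h)
  · exact h.2

/-- A common point has `φ = 0`, hence lies in the hull of the part of `A` on that hyperplane, and
this part is contained in `B`. -/
theorem convexHull_inter_convexHull_eq {E : Type*} [AddCommGroup E] [Module ℝ E] {A B : Set E}
    (φ : E →ᵃ[ℝ] ℝ) (hA : ∀ x ∈ A, φ x ≤ 0) (hB : ∀ x ∈ B, 0 ≤ φ x)
    (hAB : ∀ x ∈ A, φ x = 0 → x ∈ B) :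
    convexHull ℝ A ∩ convexHull ℝ B = convexHull ℝ (A ∩ B) := by
  apply Set.Subset.antisymm
  · rintro x ⟨hxA, hxB⟩
    have hx : 0 ≤ φ x := by
      have hconv : Convex ℝ (φ ⁻¹' Set.Ici 0) := (convex_Ici 0).affine_preimage φ
      exact convexHull_min (fun y hy => hB y hy) hconv hxB
    refine convexHull_mono (?_ : A ∩ {y | φ y = 0} ⊆ A ∩ B)
      (mem_convexHull_inter_of_nonpos A φ hA hxA hx)
    exact fun y hy => ⟨hy.1, hAB y hy.1 hy.2⟩
  · exact Set.subset_inter (convexHull_mono Set.inter_subset_left)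
      (convexHull_mono Set.inter_subset_right)

theorem det_ne_zero_of_small_off_diag {n : ℕ} (M : Matrix (Fin n) (Fin n) ℝ)
    (h1 : ∀ i, M i i = 1) (h0 : ∀ i j, i ≠ j → |M i j| ≤ 1 / (4 * n)) : M.det ≠ 0 := by
  apply det_ne_zero_of_sum_row_lt_diag
  intro k
  have hn : (0 : ℝ) < n := by exact_mod_cast k.pos
  rw [h1, norm_one]
  calc ∑ j ∈ Finset.univ.erase k, ‖M k j‖ ≤ ∑ j ∈ Finset.univ.erase k, 1 / (4 * (n : ℝ)) :=
        Finset.sum_le_sum fun j hj => h0 k j (Finset.ne_of_mem_erase hj).symm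
    _ ≤ ∑ j : Fin n, 1 / (4 * (n : ℝ)) :=
        Finset.sum_le_sum_of_subset_of_nonneg (Finset.subset_univ _) fun _ _ _ => by positivity
    _ = 1 / 4 := by
        rw [Finset.sum_const, Finset.card_univ, Fintype.card_fin, nsmul_eq_mul]
        field_simp
    _ < 1 := by norm_num

/-- If `|c k|` is maximal, each row gives `|1 - c i| ≤ |c k| / 4`. Hence `|c k| ≤ 4 / 3` and `c i ≥
2 / 3`. -/
theorem exists_solution_ge_half {n : ℕ} (M : Matrix (Fin n) (Fin n) ℝ)
    (h1 : ∀ i, M i i = 1) (h0 : ∀ i j, i ≠ j → |M i j| ≤ 1 / (4 * n)) :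
    ∃ c : Fin n → ℝ, (∀ i, ∑ j, M i j * c j = 1) ∧ ∀ i, 1 / 2 ≤ c i := by
  have hM : IsUnit M := by
    rw [Matrix.isUnit_iff_isUnit_det]
    exact (det_ne_zero_of_small_off_diag M h1 h0).isUnit
  obtain ⟨c, hc⟩ := Matrix.mulVec_surjective_iff_isUnit.2 hM (fun _ => 1)
  have hc' : ∀ i, ∑ j, M i j * c j = 1 := fun i => congrFun hc i
  refine ⟨c, hc', fun i => ?_⟩
  have hn : (0 : ℝ) < n := by exact_mod_cast i.pos
  have : Nonempty (Fin n) := ⟨i⟩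
  obtain ⟨k, hk⟩ := Finite.exists_max fun i => |c i|
  have hdev : ∀ i, |1 - c i| ≤ |c k| / 4 := by
    intro i
    have hsum : 1 - c i = ∑ j ∈ Finset.univ.erase i, M i j * c j := by
      rw [← hc' i, ← Finset.add_sum_erase _ _ (Finset.mem_univ i), h1]
      ring
    rw [hsum]
    calc |∑ j ∈ Finset.univ.erase i, M i j * c j|
        ≤ ∑ j ∈ Finset.univ.erase i, |M i j * c j| := Finset.abs_sum_le_sum_abs _ _
      _ ≤ ∑ j ∈ Finset.univ.erase i, 1 / (4 * (n : ℝ)) * |c k| :=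
          Finset.sum_le_sum fun j hj => by
            rw [abs_mul]
            exact mul_le_mul (h0 i j (Finset.ne_of_mem_erase hj).symm) (hk j) (abs_nonneg _)
              (by positivity)
      _ ≤ ∑ j : Fin n, 1 / (4 * (n : ℝ)) * |c k| :=
          Finset.sum_le_sum_of_subset_of_nonneg (Finset.subset_univ _)
            fun _ _ _ => by positivity
      _ = |c k| / 4 := by
          rw [Finset.sum_const, Finset.card_univ, Fintype.card_fin, nsmul_eq_mul]
          field_simp
  have hk1 := abs_le.1 (hdev k)
  have hck : |c k| ≤ 4 / 3 := by
    have : |c k| ≤ |1 - c k| + 1 := by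
      have := abs_sub_abs_le_abs_sub (c k) 1
      rw [abs_one, abs_sub_comm] at this
      linarith
    linarith [hdev k]
  have := (abs_le.1 (hdev i)).2
  linarith

/-! ### Scarf facets as simplices in an affine chart. -/

section Embedding

variable {d : ℕ} (pos : ℕ → Fin (d + 1) → ℤ)

/-- The base of the exponential embedding. -/
noncomputable def expBase (d : ℕ) : ℝ := 4 * ((d + 1 : ℕ) : ℝ)

theorem four_le_expBase (d : ℕ) : 4 ≤ expBase d := by
  have : (1 : ℝ) ≤ ((d + 1 : ℕ) : ℝ) := by exact_mod_cast Nat.succ_le_succ (Nat.zero_le _)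
  unfold expBase
  linarith

/-- The exponential embedding in an affine chart. -/
noncomputable def expEmbedding (x : ℕ) : EuclideanSpace ℝ (Fin d) :=
  WithLp.toLp 2 fun k => expBase d ^ (pos x k.castSucc - pos x (Fin.last d))

/-- The affine functional with the given homogeneous coefficients. -/
noncomputable def chartFunctional (c : Fin (d + 1) → ℝ) : EuclideanSpace ℝ (Fin d) →ᵃ[ℝ] ℝ :=
  (∑ k : Fin d, c k.castSucc • (EuclideanSpace.proj k : EuclideanSpace ℝ (Fin d) →L[ℝ] ℝ)
    ).toLinearMap.toAffineMap + AffineMap.const ℝ _ (c (Fin.last d))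

theorem chartFunctional_expEmbedding (c : Fin (d + 1) → ℝ) (x : ℕ) :
    chartFunctional c (expEmbedding pos x)
      = (∑ k, c k * expBase d ^ pos x k) * (expBase d ^ pos x (Fin.last d))⁻¹ := by
  have ht : expBase d ≠ 0 := by linarith [four_le_expBase d]
  have hl : expBase d ^ pos x (Fin.last d) ≠ 0 := zpow_ne_zero _ ht
  rw [Fin.sum_univ_castSucc, add_mul, Finset.sum_mul, mul_assoc (c (Fin.last d)),
    mul_inv_cancel₀ hl]
  simp [chartFunctional, expEmbedding, zpow_sub₀ ht, div_eq_mul_inv, mul_assoc]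

variable {pos} {X : Set ℕ} {p : Fin (d + 1) → ℕ}

/-- The normalised matrix of a facet. -/
noncomputable def facetMatrix (pos : ℕ → Fin (d + 1) → ℤ) (p : Fin (d + 1) → ℕ) :
    Matrix (Fin (d + 1)) (Fin (d + 1)) ℝ :=
  Matrix.of fun i j => expBase d ^ (pos (p i) j - pos (p j) j)

theorem facetMatrix_diag (i : Fin (d + 1)) : facetMatrix pos p i i = 1 := by
  simp [facetMatrix]

theorem IsScarfFacet.facetMatrix_off_diag (h : IsScarfFacet pos X p) (i j : Fin (d + 1))
    (hij : i ≠ j) : |facetMatrix pos p i j| ≤ 1 / (4 * ((d + 1 : ℕ) : ℝ)) := by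
  have ht : 4 ≤ expBase d := four_le_expBase d
  have hlt := h.2.1 i j hij
  rw [facetMatrix, Matrix.of_apply, abs_of_pos (zpow_pos (by linarith) _), one_div]
  change _ ≤ (expBase d)⁻¹
  rw [← zpow_neg_one]
  exact zpow_le_zpow_right₀ (by linarith) (by omega)

theorem IsScarfFacet.injective (h : IsScarfFacet pos X p) : Function.Injective p := by
  intro i j hij
  by_contra hne
  have := h.2.1 i j hne
  rw [hij] at this
  exact lt_irrefl _ this

/-- A facet has a supporting functional, equal to `1` exactly on its vertices. -/
theorem IsScarfFacet.exists_support (h : IsScarfFacet pos X p) :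
    ∃ c : Fin (d + 1) → ℝ, (∀ q ∈ Set.range p, ∑ k, c k * expBase d ^ pos q k = 1) ∧
      ∀ q ∈ X, q ∉ Set.range p → 1 < ∑ k, c k * expBase d ^ pos q k := by
  have ht : 4 ≤ expBase d := four_le_expBase d
  have ht0 : expBase d ≠ 0 := by linarith
  obtain ⟨c, hc, hc2⟩ := exists_solution_ge_half (facetMatrix pos p) facetMatrix_diag
    h.facetMatrix_off_diag
  have hterm : ∀ q k, c k * expBase d ^ (-pos (p k) k) * expBase d ^ pos q k
      = expBase d ^ (pos q k - pos (p k) k) * c k := by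
    intro q k
    rw [mul_assoc, ← zpow_add₀ ht0, mul_comm]
    congr 2
    ring
  refine ⟨fun k => c k * expBase d ^ (-pos (p k) k), ?_, ?_⟩
  · rintro q ⟨i, rfl⟩
    simp_rw [hterm]
    exact hc i
  · intro q hq hqp
    obtain ⟨j, hj⟩ := h.2.2 q hq hqp
    simp_rw [hterm]
    have hpos : ∀ k, 0 < expBase d ^ (pos q k - pos (p k) k) := fun k =>
      zpow_pos (by linarith) _
    have hge : expBase d ≤ expBase d ^ (pos q j - pos (p j) j) := by
      conv_lhs => rw [← zpow_one (expBase d)]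
      exact zpow_le_zpow_right₀ (by linarith) (by omega)
    -- The coordinate in which `q` exceeds the facet already contributes at least `2`; the other
    -- terms are nonnegative.
    calc (1 : ℝ) < 4 * (1 / 2) := by norm_num
      _ ≤ expBase d ^ (pos q j - pos (p j) j) * c j :=
          mul_le_mul (ht.trans hge) (hc2 j) (by norm_num) (hpos j).le
      _ ≤ _ := Finset.single_le_sum
          (f := fun k => expBase d ^ (pos q k - pos (p k) k) * c k)
          (fun k _ => mul_nonneg (hpos k).le (by linarith [hc2 k])) (Finset.mem_univ j)

theorem IsScarfFacet.affineIndependent (h : IsScarfFacet pos X p) :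
    AffineIndependent ℝ fun j => expEmbedding pos (p j) := by
  have ht0 : expBase d ≠ 0 := by linarith [four_le_expBase d]
  rw [affineIndependent_iff_of_fintype]
  intro w hw hw' i
  rw [Finset.univ.weightedVSub_eq_linear_combination hw] at hw'
  -- In homogeneous coordinates the last coordinate encodes that the weights sum to zero.
  have hsum : ∀ k, ∑ j, w j * expBase d ^ (pos (p j) k - pos (p j) (Fin.last d)) = 0 := by
    intro k
    induction k using Fin.lastCases with
    | last => simpa using hw
    | cast k =>
      have := congrArg (fun v : EuclideanSpace ℝ (Fin d) => v k) hw'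
      simpa [expEmbedding] using this
  have hdet := det_ne_zero_of_small_off_diag _ facetMatrix_diag h.facetMatrix_off_diag
  have hzero := Matrix.eq_zero_of_vecMul_eq_zero hdet
    (v := fun j => w j * expBase d ^ (-pos (p j) (Fin.last d))) (by
      funext k
      have := congrArg (· * expBase d ^ (-pos (p k) k)) (hsum k)
      simp only [Finset.sum_mul, zero_mul] at this
      change ∑ j, w j * expBase d ^ (-pos (p j) (Fin.last d)) * facetMatrix pos p j k = 0
      refine Eq.trans (Finset.sum_congr rfl fun j _ => ?_) this
      simp only [facetMatrix, Matrix.of_apply]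
      rw [mul_assoc, mul_assoc, ← zpow_add₀ ht0, ← zpow_add₀ ht0]
      congr 2
      ring)
  have := congrFun hzero i
  simpa [zpow_ne_zero _ ht0] using this

/-- The chart keeps only differences of coordinates, so injectivity is required of one such
difference. -/
theorem geometricallyEmbeddable_of_isScarfFacet (H : Hypergraph ℕ) (X : Set ℕ)
    (hinj : ∃ k l, Function.Injective fun x => pos x k - pos x l)
    (hE : ∀ e ∈ E(H), ∃ p, IsScarfFacet pos X p ∧ e = Set.range p) :
    H.GeometricallyEmbeddable (d + 1) d := by
  have ht : 4 ≤ expBase d := four_le_expBase d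
  refine ⟨expEmbedding pos, ?_, ?_, ?_⟩
  · obtain ⟨k, l, hkl⟩ := hinj
    refine Set.injOn_of_injective fun x y hxy => hkl ?_
    have hdiff : ∀ k, pos x k - pos x (Fin.last d) = pos y k - pos y (Fin.last d) := by
      intro k
      induction k using Fin.lastCases with
      | last => rw [sub_self, sub_self]
      | cast k =>
        have := congrArg (fun v : EuclideanSpace ℝ (Fin d) => v k) hxy
        exact zpow_right_injective₀ (by linarith) (by linarith) this
    have := hdiff k
    have := hdiff l
    change pos x k - pos x l = pos y k - pos y l
    omega
  · intro e he
    obtain ⟨p, hp, rfl⟩ := hE e he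
    exact ⟨fun j => expEmbedding pos (p j), hp.affineIndependent, by
      rw [← Set.range_comp]; rfl⟩
  · intro e₁ he₁ e₂ he₂ _
    obtain ⟨p₁, hp₁, rfl⟩ := hE e₁ he₁
    obtain ⟨p₂, hp₂, rfl⟩ := hE e₂ he₂
    obtain ⟨c₁, hc₁, hc₁'⟩ := hp₁.exists_support
    obtain ⟨c₂, hc₂, hc₂'⟩ := hp₂.exists_support
    have hval : ∀ x, chartFunctional (c₁ - c₂) (expEmbedding pos x)
        = (∑ k, c₁ k * expBase d ^ pos x k - ∑ k, c₂ k * expBase d ^ pos x k)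
          * (expBase d ^ pos x (Fin.last d))⁻¹ := by
      intro x
      rw [chartFunctional_expEmbedding, ← Finset.sum_sub_distrib]
      simp only [Pi.sub_apply, sub_mul]
    have hpos : ∀ x, 0 < (expBase d ^ pos x (Fin.last d))⁻¹ := fun x =>
      inv_pos.2 (zpow_pos (by linarith) _)
    refine convexHull_inter_convexHull_eq (chartFunctional (c₁ - c₂)) ?_ ?_ ?_
    · rintro _ ⟨x, hx, rfl⟩
      rw [hval, hc₁ x hx]
      refine mul_nonpos_of_nonpos_of_nonneg ?_ (hpos x).le
      by_cases hx₂ : x ∈ Set.range p₂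
      · rw [hc₂ x hx₂, sub_self]
      · obtain ⟨j, rfl⟩ := hx
        linarith [hc₂' _ (hp₁.1 j) hx₂]
    · rintro _ ⟨x, hx, rfl⟩
      rw [hval, hc₂ x hx]
      refine mul_nonneg ?_ (hpos x).le
      by_cases hx₁ : x ∈ Set.range p₁
      · rw [hc₁ x hx₁, sub_self]
      · obtain ⟨j, rfl⟩ := hx
        linarith [hc₁' _ (hp₂.1 j) hx₁]
    · rintro _ ⟨x, hx, rfl⟩ h0
      by_cases hx₂ : x ∈ Set.range p₂
      · exact ⟨x, hx₂, rfl⟩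
      · rw [hval, hc₁ x hx] at h0
        obtain ⟨j, rfl⟩ := hx
        have h2 := hc₂' _ (hp₁.1 j) hx₂
        exact absurd h0 (mul_neg_of_neg_of_pos (by linarith) (hpos _)).ne

end Embedding

/-! ### Letter assignments that give every coloring a monochromatic window. -/

/-- `p` enumerates a window of `X`: points of one color and one class under `s` that carry the
letters `0, …, d`, with `p a` leftmost and `p b` rightmost, such that all other points of the class
between `p a` and `p b` carry the last letter. -/
def IsWindow {d : ℕ} {κ γ : Type*} (a b : Fin (d + 1)) (X : Finset ℕ) (s : ℕ → κ)
    (g : ℕ → Fin (d + 2)) (c : ℕ → γ) (p : Fin (d + 1) → ℕ) : Prop :=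
  (∀ j, p j ∈ X) ∧ (∀ i j, s (p i) = s (p j)) ∧ (∀ i j, c (p i) = c (p j)) ∧
    (∀ j, g (p j) = j.castSucc) ∧ (∀ i, i ≠ a → p a < p i) ∧ (∀ i, i ≠ b → p i < p b) ∧
    ∀ q ∈ X, s q = s (p a) → p a < q → q < p b → q ∉ Set.range p → g q = Fin.last (d + 1)

/-- A finite set of `d + 1` naturals can be enumerated with prescribed places for its least and
its greatest elements. -/
theorem exists_enumeration {d : ℕ} {a b : Fin (d + 1)} (hab : a ≠ b)
    (h0 : (0 : Fin (d + 1)) ≠ Fin.last d) (S : Finset ℕ) (hS : S.card = d + 1) :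
    ∃ p : Fin (d + 1) → ℕ, Function.Injective p ∧ (∀ j, p j ∈ S) ∧
      (∀ i, i ≠ a → p a < p i) ∧ (∀ i, i ≠ b → p i < p b) := by
  obtain ⟨σ, hσa, hσb⟩ : ∃ σ : Equiv.Perm (Fin (d + 1)), σ a = 0 ∧ σ b = Fin.last d := by
    refine ⟨(Equiv.swap a 0).trans (Equiv.swap (Equiv.swap a 0 b) (Fin.last d)), ?_, ?_⟩
    · have h1 : (0 : Fin (d + 1)) ≠ Equiv.swap a 0 b := by
        intro h
        apply hab
        have := congrArg (Equiv.swap a 0) h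
        simpa using this
      simp [Equiv.swap_apply_of_ne_of_ne h1 h0]
    · simp
  have hmono := (S.orderEmbOfFin hS).strictMono
  refine ⟨fun j => S.orderEmbOfFin hS (σ j), fun i j h => ?_,
    fun j => S.orderEmbOfFin_mem hS _, fun i hi => ?_, fun i hi => ?_⟩
  · exact σ.injective ((S.orderEmbOfFin hS).injective h)
  · apply hmono
    rw [hσa]
    exact Fin.pos_iff_ne_zero.2 fun h => hi (σ.injective (h.trans hσa.symm))
  · apply hmono
    rw [hσb]
    exact Fin.lt_last_iff_ne_last.2 fun h => hi (σ.injective (h.trans hσb.symm))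

/-- The pattern realised by a sufficiently large block for a given coloring. -/
theorem exists_pattern {d N : ℕ} {a b : Fin (d + 1)} (hab : a ≠ b)
    (h0 : (0 : Fin (d + 1)) ≠ Fin.last d) (B : Finset ℕ) (hB : N * d < B.card)
    (c : ℕ → Fin N) :
    ∃ h : B → Fin (d + 2), ∃ p : Fin (d + 1) → ℕ, (∀ j, p j ∈ B) ∧
      (∀ i j, c (p i) = c (p j)) ∧ (∀ x : B, ∀ j, x = p j → h x = j.castSucc) ∧
      (∀ i, i ≠ a → p a < p i) ∧ (∀ i, i ≠ b → p i < p b) ∧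
      ∀ x : B, (x : ℕ) ∉ Set.range p → h x = Fin.last (d + 1) := by
  classical
  obtain ⟨y, -, hy⟩ := Finset.exists_lt_card_fiber_of_mul_lt_card_of_maps_to
    (s := B) (t := (Finset.univ : Finset (Fin N))) (f := c) (n := d) (by simp) (by simpa using hB)
  obtain ⟨S, hSB, hS⟩ := Finset.exists_subset_card_eq (Nat.succ_le_of_lt hy)
  obtain ⟨p, hp, hpS, hpa, hpb⟩ := exists_enumeration hab h0 S hS
  have hpB : ∀ j, p j ∈ B ∧ c (p j) = y := fun j => by simpa using hSB (hpS j)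
  refine ⟨fun x => if h : ∃ j, (x : ℕ) = p j then h.choose.castSucc else Fin.last (d + 1), p,
    fun j => (hpB j).1, fun i j => (hpB i).2.trans (hpB j).2.symm, fun x j hj => ?_, hpa, hpb,
    fun x hx => ?_⟩
  · have hex : ∃ j, (x : ℕ) = p j := ⟨j, hj⟩
    beta_reduce
    rw [dif_pos hex]
    congr 1
    exact hp (hex.choose_spec.symm.trans hj)
  · beta_reduce
    rw [dif_neg]
    rintro ⟨j, hj⟩
    exact hx ⟨j, hj.symm⟩

/-- In a set that is large compared to the number of classes, some class has an initial segment
with `L` elements. -/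
theorem exists_block {κ : Type*} [Fintype κ] (s : ℕ → κ) (L : ℕ) (X : Finset ℕ)
    (hX : Fintype.card κ * L < X.card + 1) (hκ : 0 < Fintype.card κ) :
    ∃ B ⊆ X, B.card = L ∧ (∀ x ∈ B, ∀ y ∈ B, s x = s y) ∧
      ∀ x ∈ B, ∀ y ∈ X, y ∉ B → s y = s x → x < y := by
  classical
  have : Nonempty κ := Fintype.card_pos_iff.1 hκ
  obtain ⟨k, -, hk⟩ := Finset.exists_le_card_fiber_of_mul_le_card_of_maps_to
    (s := X) (t := (Finset.univ : Finset κ)) (f := s) (n := L) (by simp) Finset.univ_nonempty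
    (by simpa using Nat.lt_succ_iff.1 hX)
  set S := X.filter (fun x => s x = k) with hSdef
  have hS : ∀ x, x ∈ S ↔ x ∈ X ∧ s x = k := by simp [hSdef]
  let φ := S.orderEmbOfFin rfl
  let B := (Finset.univ.filter (fun i : Fin S.card => (i : ℕ) < L)).map φ.toEmbedding
  have hBS : ∀ x ∈ B, x ∈ S := by
    intro x hx
    obtain ⟨i, -, rfl⟩ := Finset.mem_map.1 hx
    exact S.orderEmbOfFin_mem rfl i
  refine ⟨B, fun x hx => ((hS x).1 (hBS x hx)).1, ?_,
    fun x hx y hy => ((hS x).1 (hBS x hx)).2.trans ((hS y).1 (hBS y hy)).2.symm, ?_⟩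
  · rw [Finset.card_map, Fin.card_filter_val_lt]
    exact min_eq_right hk
  · intro x hx y hy hyB hyx
    have hyS : y ∈ S := (hS y).2 ⟨hy, hyx.trans ((hS x).1 (hBS x hx)).2⟩
    obtain ⟨j, hj⟩ : y ∈ Set.range φ := by
      rw [Finset.range_orderEmbOfFin]; exact hyS
    obtain ⟨i, hi, rfl⟩ := Finset.mem_map.1 hx
    rw [← hj]
    apply φ.strictMono
    rw [Fin.lt_def]
    by_contra hji
    apply hyB
    rw [← hj]
    refine Finset.mem_map.2 ⟨j, ?_, rfl⟩
    have : (i : ℕ) < L := by simpa using hi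
    simp only [Finset.mem_filter, Finset.mem_univ, true_and]
    omega

/-- One assignment of letters leaves few colorings without a window. -/
theorem exists_letters {d N : ℕ} {a b : Fin (d + 1)} (hab : a ≠ b)
    (h0 : (0 : Fin (d + 1)) ≠ Fin.last d) {κ ι : Type*} [Fintype κ] (s : ℕ → κ)
    (hκ : 0 < Fintype.card κ) (L : ℕ) (hL : N * d < L) (col : ι → ℕ → Fin N) (w : ℕ) :
    ∀ (X : Finset ℕ), Fintype.card κ * L + w * L ≤ X.card → ∀ (C : Finset ι),
      ∃ g : ℕ → Fin (d + 2), ∃ C' ⊆ C,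
        (∀ i ∈ C, i ∉ C' → ∃ p, IsWindow a b X s g (col i) p) ∧
        (C'.card : ℝ) ≤ (1 - 1 / ((d + 2 : ℕ) ^ L : ℝ)) ^ w * C.card := by
  classical
  induction w with
  | zero => exact fun X _ C => ⟨fun _ => 0, C, subset_rfl, fun i h h' => absurd h h', by simp⟩
  | succ w ih =>
    intro X hX C
    have hw : (w + 1) * L = w * L + L := by ring
    obtain ⟨B, hBX, hBL, hBs, hBlt⟩ := exists_block s L X (by omega) hκ
    choose h p hpB hpc hph hpa hpb hpn using
      fun i => exists_pattern hab h0 B (hBL ▸ hL) (col i)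
    have hQ : (0 : ℝ) < ((d + 2 : ℕ) : ℝ) ^ L := by positivity
    -- Averaging over the `(d + 2) ^ L` patterns: some `h'` is the pattern of at least that fraction
    -- of `C`.
    obtain ⟨h', -, hh'⟩ := Finset.exists_le_card_fiber_of_nsmul_le_card_of_maps_to
      (s := C) (t := (Finset.univ : Finset (B → Fin (d + 2)))) (f := h)
      (b := (C.card : ℝ) / ((d + 2 : ℕ) ^ L : ℝ)) (by simp) Finset.univ_nonempty (by
        rw [Finset.card_univ, Fintype.card_fun, Fintype.card_coe, hBL, Fintype.card_fin,
          nsmul_eq_mul, Nat.cast_pow, mul_div_cancel₀ _ hQ.ne'])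
    obtain ⟨g, C', hC', hwin, hcard⟩ := ih (X \ B)
      (by rw [Finset.card_sdiff_of_subset hBX, hBL]; omega) (C.filter fun i => ¬ h i = h')
    refine ⟨fun x => if hx : x ∈ B then h' ⟨x, hx⟩ else g x, C',
      hC'.trans (Finset.filter_subset _ _), fun i hi hi' => ?_, ?_⟩
    · by_cases hhi : h i = h'
      · refine ⟨p i, fun j => hBX (hpB i j), fun j k => hBs _ (hpB i j) _ (hpB i k), hpc i,
          fun j => ?_, hpa i, hpb i, fun q hq hqs hqa hqb hqn => ?_⟩
        · simp only [hpB i j, dite_true]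
          rw [← hhi]
          exact hph i _ j rfl
        -- Since `B` is an initial segment of its class, later letters cannot spoil a window in `B`,
        -- nor can `B` spoil later windows.
        · have hqB : q ∈ B := by
            by_contra hqB
            exact absurd (hBlt _ (hpB i b) q hq hqB (hqs.trans (hBs _ (hpB i a) _ (hpB i b))))
              (by omega)
          simp only [hqB, dite_true]
          rw [← hhi]
          exact hpn i _ hqn
      · obtain ⟨r, hrX, hrs, hrc, hrg, hra, hrb, hrn⟩ :=
          hwin i (Finset.mem_filter.2 ⟨hi, hhi⟩) hi'
        have hrB : ∀ j, r j ∉ B := fun j => (Finset.mem_sdiff.1 (hrX j)).2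
        refine ⟨r, fun j => (Finset.mem_sdiff.1 (hrX j)).1, hrs, hrc, fun j => ?_, hra, hrb,
          fun q hq hqs hqa hqb hqn => ?_⟩
        · simp only [hrB j, dite_false, hrg]
        · have hqB : q ∉ B := by
            intro hqB
            have := hBlt q hqB (r a) (Finset.mem_sdiff.1 (hrX a)).1 (hrB a) hqs.symm
            omega
          simp only [hqB, dite_false]
          exact hrn q (Finset.mem_sdiff.2 ⟨hq, hqB⟩) hqs hqa hqb hqn
    · have hsplit := Finset.card_filter_add_card_filter_not (s := C) (fun i => h i = h')
      have hsplit' : ((C.filter fun i => h i = h').card : ℝ)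
          + (C.filter fun i => ¬ h i = h').card = C.card := by exact_mod_cast hsplit
      have hρ : (0 : ℝ) ≤ 1 - 1 / ((d + 2 : ℕ) ^ L : ℝ) := by
        rw [sub_nonneg, div_le_one hQ]
        exact one_le_pow₀ (by exact_mod_cast Nat.succ_le_succ (Nat.zero_le _))
      refine hcard.trans ?_
      rw [pow_succ, mul_assoc]
      refine mul_le_mul_of_nonneg_left ?_ (pow_nonneg hρ _)
      rw [sub_mul, one_mul, one_div_mul_eq_div]
      linarith

/-- Successive assignments of letters, each relative to the classes given by the previous ones. -/
theorem exists_letter_sequence {d N : ℕ} {a b : Fin (d + 1)} (hab : a ≠ b)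
    (h0 : (0 : Fin (d + 1)) ≠ Fin.last d) {ι : Type*} (L : ℕ) (hL : N * d < L)
    (col : ι → ℕ → Fin N) (w T₀ : ℕ) (X : Finset ℕ) (hX : (d + 2) ^ T₀ * L + w * L ≤ X.card)
    (C : Finset ι) (T : ℕ) (hT : T ≤ T₀) :
    ∃ g : ℕ → ℕ → Fin (d + 2), ∃ C' ⊆ C,
      (∀ i ∈ C, i ∉ C' → ∃ t < T, ∃ p,
        IsWindow a b X (fun x (k : Fin t) => g k x) (g t) (col i) p) ∧
      (C'.card : ℝ) ≤ ((1 - 1 / ((d + 2 : ℕ) ^ L : ℝ)) ^ w) ^ T * C.card := by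
  induction T with
  | zero => exact ⟨fun _ _ => 0, C, subset_rfl, fun i h h' => absurd h h', by simp⟩
  | succ T ih =>
    obtain ⟨g, C', hC', hwin, hcard⟩ := ih (by omega)
    have hpow : (d + 2) ^ T * L ≤ (d + 2) ^ T₀ * L :=
      Nat.mul_le_mul_right _ (Nat.pow_le_pow_right (by omega) (by omega))
    obtain ⟨g', C'', hC'', hwin', hcard'⟩ := exists_letters hab h0
      (fun x (k : Fin T) => g k x) (by simp) L hL col w X (by simp; omega) C'
    -- Windows at earlier levels depend only on earlier letters, so they survive the new assignment.
    have hupd : ∀ t ≤ T, (fun x (k : Fin t) => Function.update g T g' k x)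
        = fun x (k : Fin t) => g k x := by
      intro t ht
      funext x k
      rw [Function.update_of_ne (by have := k.2; omega)]
    refine ⟨Function.update g T g', C'', hC''.trans hC', fun i hi hi' => ?_, ?_⟩
    · by_cases hiC : i ∈ C'
      · obtain ⟨p, hp⟩ := hwin' i hiC hi'
        refine ⟨T, by omega, p, ?_⟩
        rw [hupd T le_rfl, Function.update_self]
        exact hp
      · obtain ⟨t, ht, p, hp⟩ := hwin i hi hiC
        refine ⟨t, by omega, p, ?_⟩
        rw [hupd t ht.le, Function.update_of_ne (by omega)]
        exact hp
    · have hρ : (0 : ℝ) ≤ 1 - 1 / ((d + 2 : ℕ) ^ L : ℝ) := by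
        rw [sub_nonneg, div_le_one (by positivity)]
        exact one_le_pow₀ (by exact_mod_cast Nat.succ_le_succ (Nat.zero_le _))
      refine hcard'.trans ?_
      rw [pow_succ' _ T, mul_assoc]
      exact mul_le_mul_of_nonneg_left hcard (pow_nonneg hρ _)

/-- For a suitable sequence of letter assignments, every coloring of a long interval has a
window. -/
theorem exists_letter_sequence_forall_window {d : ℕ} {a b : Fin (d + 1)} (hab : a ≠ b)
    (h0 : (0 : Fin (d + 1)) ≠ Fin.last d) (N : ℕ) :
    ∃ (M T : ℕ) (g : ℕ → ℕ → Fin (d + 2)), ∀ c : ℕ → Fin (N + 1), ∃ t < T, ∃ p,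
      IsWindow a b (Finset.range M) (fun x (k : Fin t) => g k x) (g t) c p := by
  set L := (N + 1) * d + 1 with hLdef
  set ρ : ℝ := 1 - 1 / ((d + 2 : ℕ) ^ L : ℝ) with hρdef
  have hQ : (1 : ℝ) ≤ ((d + 2 : ℕ) : ℝ) ^ L :=
    one_le_pow₀ (by exact_mod_cast Nat.succ_le_succ (Nat.zero_le _))
  have hρ0 : 0 ≤ ρ := by
    rw [hρdef, sub_nonneg, div_le_one (by positivity)]
    exact hQ
  have hρ1 : ρ < 1 := by
    have : 0 < 1 / ((d + 2 : ℕ) ^ L : ℝ) := by positivity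
    linarith
  have hN : (0 : ℝ) < ((N + 1 : ℕ) : ℝ) ^ (2 * L) := by positivity
  -- There are `((N + 1) ^ (2 * L)) ^ K` colorings and a fraction of at most `(ρ ^ T) ^ K` survives,
  -- so `ρ ^ T * (N + 1) ^ (2 * L) < 1` suffices.
  obtain ⟨T, hT⟩ := exists_pow_lt_of_lt_one (one_div_pos.2 hN) hρ1
  set K := (d + 2) ^ T with hK
  set M := 2 * L * K with hM
  let col : (Fin M → Fin (N + 1)) → ℕ → Fin (N + 1) :=
    fun c x => if hx : x < M then c ⟨x, hx⟩ else 0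
  obtain ⟨g, C', -, hwin, hcard⟩ := exists_letter_sequence hab h0 L (by omega) col K T
    (Finset.range M) (by rw [Finset.card_range, hM]; exact le_of_eq (by ring)) Finset.univ T le_rfl
  have hC' : C' = ∅ := by
    rw [← Finset.card_eq_zero, ← Nat.lt_one_iff, ← Nat.cast_lt (α := ℝ)]
    refine hcard.trans_lt ?_
    rw [Finset.card_univ, Fintype.card_fun, Fintype.card_fin, Fintype.card_fin, ← hρdef, hM,
      ← pow_mul, mul_comm K T, pow_mul, pow_mul, Nat.cast_pow, Nat.cast_pow, ← mul_pow,
      Nat.cast_one]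
    refine pow_lt_one₀ (by positivity) ?_ (by positivity)
    rwa [lt_div_iff₀ hN] at hT
  refine ⟨M, T, g, fun c => ?_⟩
  obtain ⟨t, ht, p, hpX, hps, hpc, hpr⟩ :=
    hwin (fun x => c x) (Finset.mem_univ _) (by simp [hC'])
  refine ⟨t, ht, p, hpX, hps, fun i j => ?_, hpr⟩
  have := hpc i j
  have hlt : ∀ j, p j < M := fun j => Finset.mem_range.1 (hpX j)
  simpa [col, hlt] using this

/-! ### Lexicographic order on words and the passage from windows to facets. -/

/-- The value in base `B` of the first `t` letters of `x` under the weights `v`. -/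
def baseValue {D : Type*} (B : ℕ) (v : D → ℕ) (g : ℕ → ℕ → D) : ℕ → ℕ → ℤ
  | 0, _ => 0
  | t + 1, x => B * baseValue B v g t x + v (g t x)

section BaseValue

variable {D : Type*} {B : ℕ} {v : D → ℕ} {g : ℕ → ℕ → D}

theorem baseValue_congr {t x y : ℕ} (h : ∀ k < t, g k x = g k y) :
    baseValue B v g t x = baseValue B v g t y := by
  induction t with
  | zero => rfl
  | succ t ih =>
    rw [baseValue, baseValue, ih fun k hk => h k (by omega), h t (by omega)]

theorem baseValue_lt_of_lt (hv : ∀ a, v a < B) {t T x y : ℕ} (htT : t ≤ T)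
    (h : baseValue B v g t x < baseValue B v g t y) :
    baseValue B v g T x < baseValue B v g T y := by
  induction T, htT using Nat.le_induction with
  | base => exact h
  | succ T _ ih =>
    rw [baseValue, baseValue]
    have h1 : (v (g T x) : ℤ) < B := by exact_mod_cast hv _
    have h2 : (0 : ℤ) ≤ v (g T y) := by positivity
    nlinarith

theorem baseValue_lt_of_letter_lt (hv : ∀ a, v a < B) {t T x y : ℕ} (htT : t < T)
    (h : ∀ k < t, g k x = g k y) (hlt : v (g t x) < v (g t y)) :
    baseValue B v g T x < baseValue B v g T y := by
  refine baseValue_lt_of_lt hv (Nat.succ_le_of_lt htT) ?_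
  rw [baseValue, baseValue, baseValue_congr h]
  have : (v (g t x) : ℤ) < v (g t y) := by exact_mod_cast hlt
  linarith

theorem letters_eq_of_baseValue_eq (hv : ∀ a, v a < B) (hinj : Function.Injective v) {t x y : ℕ}
    (h : baseValue B v g t x = baseValue B v g t y) : ∀ k < t, g k x = g k y := by
  induction t with
  | zero => intro k hk; omega
  | succ t ih =>
    have heq : baseValue B v g t x = baseValue B v g t y := by
      rcases lt_trichotomy (baseValue B v g t x) (baseValue B v g t y) with h' | h' | h'
      · exact absurd h (baseValue_lt_of_lt hv (Nat.le_succ t) h').ne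
      · exact h'
      · exact absurd h (baseValue_lt_of_lt hv (Nat.le_succ t) h').ne'
    intro k hk
    rcases Nat.lt_succ_iff_lt_or_eq.1 hk with hk | rfl
    · exact ih heq k hk
    · rw [baseValue, baseValue, heq] at h
      apply hinj
      exact_mod_cast add_left_cancel h

end BaseValue

/-- The coordinates of the points determined by `T` letter assignments. -/
def letterCoord {d : ℕ} (a b : Fin (d + 1)) (g : ℕ → ℕ → Fin (d + 2)) (T x : ℕ)
    (j : Fin (d + 1)) : ℤ :=
  if j = 0 then -baseValue (d + 2) Fin.val g T x
  else if j = Fin.last d then baseValue (d + 2) Fin.val g T x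
  else if j = a then -x
  else if j = b then x
  else baseValue (d + 2) (fun i => if i = j.castSucc then 1 else 0) g T x

/-- A point `q` not exceeding the facet lies between `p a` and `p b`. Its word lies between those of
`p 0` and `p (Fin.last d)`, so it has their prefix. The window then gives it the largest letter,
which puts its word above that of `p (Fin.last d)`. -/
theorem IsWindow.isScarfFacet {d : ℕ} {a b : Fin (d + 1)} (hab : a ≠ b) (ha0 : a ≠ 0)
    (hal : a ≠ Fin.last d) (hb0 : b ≠ 0) (hbl : b ≠ Fin.last d)
    (h0 : (0 : Fin (d + 1)) ≠ Fin.last d) {γ : Type*} {X : Finset ℕ}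
    {g : ℕ → ℕ → Fin (d + 2)} {t T : ℕ} (htT : t < T) {c : ℕ → γ} {p : Fin (d + 1) → ℕ}
    (h : IsWindow a b X (fun x (k : Fin t) => g k x) (g t) c p) :
    IsScarfFacet (letterCoord a b g T) X p := by
  obtain ⟨hpX, hps, -, hpg, hpa, hpb, hpn⟩ := h
  have hpre : ∀ i j, ∀ k < t, g k (p i) = g k (p j) := fun i j k hk =>
    congrFun (hps i j) ⟨k, hk⟩
  have hv : ∀ i : Fin (d + 2), (i : ℕ) < d + 2 := fun i => i.2
  refine ⟨hpX, fun i j hij => ?_, fun q hq hqp => ?_⟩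
  · unfold letterCoord
    split_ifs with h1 h2 h3 h4
    · subst h1
      refine neg_lt_neg (baseValue_lt_of_letter_lt hv htT (hpre _ _) ?_)
      simp only [hpg, Fin.val_castSucc]
      exact Fin.pos_iff_ne_zero.2 hij
    · subst h2
      refine baseValue_lt_of_letter_lt hv htT (hpre _ _) ?_
      simp only [hpg, Fin.val_castSucc]
      exact Fin.lt_last_iff_ne_last.2 hij
    · subst h3
      have := hpa i hij
      omega
    · subst h4
      have := hpb i hij
      omega
    · refine baseValue_lt_of_letter_lt (fun k => ?_) htT (hpre _ _) ?_
      · split_ifs <;> omega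
      · simp [hpg, hij]
  · by_contra! hcon
    have hc0 := hcon 0
    have hcl := hcon (Fin.last d)
    have hca := hcon a
    have hcb := hcon b
    simp only [letterCoord, if_true, if_neg h0.symm] at hc0 hcl
    simp only [letterCoord, if_neg ha0, if_neg hal, if_neg hb0, if_neg hbl, if_neg hab.symm,
      if_true] at hca hcb
    have hne : ∀ j, p j ≠ q := fun j hj => hqp ⟨j, hj⟩
    have hqa : p a < q := by have := hne a; omega
    have hqb : q < p b := by have := hne b; omega
    have heq : baseValue (d + 2) Fin.val g t q
        = baseValue (d + 2) Fin.val g t (p a) := by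
      rcases lt_trichotomy (baseValue (d + 2) Fin.val g t q)
        (baseValue (d + 2) Fin.val g t (p a)) with h' | h' | h'
      · rw [baseValue_congr (hpre a 0)] at h'
        have := baseValue_lt_of_lt hv htT.le h'
        omega
      · exact h'
      · rw [baseValue_congr (hpre a (Fin.last d))] at h'
        have := baseValue_lt_of_lt hv htT.le h'
        omega
    have hlet := letters_eq_of_baseValue_eq hv Fin.val_injective heq
    have hgq : g t q = Fin.last (d + 1) :=
      hpn q hq (funext fun k => hlet k k.2) hqa hqb hqp
    have : baseValue (d + 2) Fin.val g T (p (Fin.last d))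
        < baseValue (d + 2) Fin.val g T q := by
      refine baseValue_lt_of_letter_lt hv htT
        (fun k hk => (hpre _ a k hk).trans (hlet k hk).symm) ?_
      simp [hpg, hgq]
    omega

/-! ### The hypergraphs and the infinite family. -/

/-- The hypergraph of all Scarf facets of `X`, with vertex set `V`. -/
def scarfHypergraph {d : ℕ} (pos : ℕ → Fin (d + 1) → ℤ) (X V : Set ℕ) (hXV : X ⊆ V) :
    Hypergraph ℕ where
  vertexSet := V
  edgeSet := {e | ∃ p, IsScarfFacet pos X p ∧ e = Set.range p}
  subset_vertexSet_of_mem_edgeSet' := by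
    rintro _ ⟨p, hp, rfl⟩ _ ⟨j, rfl⟩
    exact hXV (hp.1 j)

/-- Geometrically embeddable hypergraphs that are not `N + 1`-colorable exist on every
sufficiently long interval. -/
theorem exists_not_weaklyColorable {d : ℕ} (hd : 3 ≤ d) (N : ℕ) :
    ∃ M₀ : ℕ, ∀ M ≥ M₀, ∃ H : Hypergraph ℕ, V(H) = Set.Iio M ∧ H.IsUniform (d + 1) ∧
      H.GeometricallyEmbeddable (d + 1) d ∧ ¬ H.WeaklyColorable (N + 1) := by
  -- The indices `0`, `1`, `2`, `d` play separate roles, so `3 ≤ d` is needed.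
  set a : Fin (d + 1) := ⟨1, by omega⟩ with ha
  set b : Fin (d + 1) := ⟨2, by omega⟩ with hb
  have hab : a ≠ b := by simp [ha, hb]
  have ha0 : a ≠ 0 := by simp [ha, Fin.ext_iff]
  have hb0 : b ≠ 0 := by simp [hb, Fin.ext_iff]
  have hal : a ≠ Fin.last d := by simp only [ha, ne_eq, Fin.ext_iff, Fin.val_last]; omega
  have hbl : b ≠ Fin.last d := by simp only [hb, ne_eq, Fin.ext_iff, Fin.val_last]; omega
  have h0 : (0 : Fin (d + 1)) ≠ Fin.last d := by
    simp only [ne_eq, Fin.ext_iff, Fin.val_last, Fin.val_zero]; omega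
  obtain ⟨M₀, T, g, hg⟩ := exists_letter_sequence_forall_window hab h0 N
  refine ⟨M₀, fun M hM => ?_⟩
  have hXV : ((Finset.range M₀ : Finset ℕ) : Set ℕ) ⊆ Set.Iio M := fun x hx =>
    (Finset.mem_range.1 hx).trans_le hM
  refine ⟨scarfHypergraph (letterCoord a b g T) (Finset.range M₀) (Set.Iio M) hXV, rfl, ?_, ?_, ?_⟩
  · rintro _ ⟨p, hp, rfl⟩
    rw [← Set.image_univ, hp.injective.encard_image, Set.encard_univ]
    simp
  · refine geometricallyEmbeddable_of_isScarfFacet (pos := letterCoord a b g T) _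
      (Finset.range M₀) ⟨b, a, fun x y hxy => ?_⟩ fun e he => he
    simp only [letterCoord, if_neg ha0, if_neg hal, if_neg hb0, if_neg hbl, if_neg hab.symm,
      if_true] at hxy
    omega
  · rintro ⟨c, hc⟩
    obtain ⟨t, ht, p, hp⟩ := hg fun x => if hx : x < M then c ⟨x, hx⟩ else 0
    have hfacet := hp.isScarfFacet hab ha0 hal hb0 hbl h0 ht
    obtain ⟨⟨x, hx⟩, ⟨y, hy⟩, ⟨i, rfl⟩, ⟨j, rfl⟩, hxy⟩ := hc _ ⟨p, hfacet, rfl⟩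
    apply hxy
    have := hp.2.2.1 i j
    have hx' : p i < M := hx
    have hy' : p j < M := hy
    simpa only [dif_pos hx', dif_pos hy'] using this

theorem Hypergraph.Isomorphic.ncard_eq {α : Type*} {H H' : Hypergraph α} (h : H.Isomorphic H') :
    V(H).ncard = V(H').ncard := by
  obtain ⟨f, hf, rfl⟩ := h
  exact hf.ncard_image.symm

theorem Hypergraph.WeaklyColorable.mono {α : Type*} {H : Hypergraph α} {k l : ℕ}
    (h : H.WeaklyColorable k) (hkl : k ≤ l) : H.WeaklyColorable l := by
  obtain ⟨c, hc⟩ := h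
  refine ⟨fun x => Fin.castLE hkl (c x), fun e he => ?_⟩
  obtain ⟨x, y, hx, hy, hxy⟩ := hc e he
  exact ⟨x, y, hx, hy, fun h => hxy (Fin.castLE_injective hkl h)⟩

theorem Hypergraph.le_weakChromaticNumber {α : Type*} {H : Hypergraph α} {N : ℕ}
    (h : ¬ H.WeaklyColorable N) : (N : ℕ∞) ≤ H.weakChromaticNumber := by
  refine le_iInf₂ fun k hk => ?_
  by_contra hlt
  exact h (hk.mono (by exact_mod_cast (not_le.1 hlt).le))

theorem mainTheorem4 (d : ℕ) (hd : 4 ≤ d) :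
    ∃ F : Set (Hypergraph ℕ),
      F.Infinite ∧
      F.Pairwise (fun H H' => ¬ Hypergraph.Isomorphic H H') ∧
      (∀ H ∈ F, V(H).Finite ∧ H.IsUniform (d + 1) ∧ H.GeometricallyEmbeddable (d + 1) d) ∧
      ∀ N : ℕ, ∃ H ∈ F, (N : ℕ∞) ≤ H.weakChromaticNumber := by
  choose M₀ hM₀ using fun N => exists_not_weaklyColorable (d := d) (by omega) N
  -- Isolated vertices pad the hypergraphs to strictly increasing sizes, which makes them pairwise
  -- non-isomorphic.
  let M : ℕ → ℕ := fun N => ∑ i ∈ Finset.range (N + 1), (M₀ i + 1)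
  have hM : StrictMono M := strictMono_nat_of_lt_succ fun N => by
    simp only [M]
    rw [Finset.sum_range_succ _ (N + 1)]
    omega
  have hle : ∀ N, M₀ N ≤ M N := fun N => by
    simp only [M]
    rw [Finset.sum_range_succ]
    omega
  choose H hV hU hE hC using fun N => hM₀ N (M N) (hle N)
  have hinj : ∀ {m n}, (H m).Isomorphic (H n) → m = n := fun {m n} h => by
    have := h.ncard_eq
    rw [hV, hV, Set.ncard_Iio_nat, Set.ncard_Iio_nat] at this
    exact hM.injective this
  refine ⟨Set.range H, Set.infinite_range_of_injective fun m n h => ?_, ?_, ?_, fun N => ?_⟩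
  · apply hinj
    rw [h]
    exact ⟨id, Set.injOn_id _, by ext <;> simp⟩
  · rintro _ ⟨m, rfl⟩ _ ⟨n, rfl⟩ hne h
    exact hne (congrArg H (hinj h))
  · rintro _ ⟨m, rfl⟩
    exact ⟨by rw [hV]; exact Set.finite_Iio _, hU m, hE m⟩
  · refine ⟨H N, ⟨N, rfl⟩, Hypergraph.le_weakChromaticNumber fun h => hC N (h.mono (by omega))⟩
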